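/- For a finite group $G$, let $\mathrm{Z}\ell^1(G)$ be the centre of the complex group algebra of $G$, with the norm $\|f\|_1=\sum_{g\in G}|f(g)|$. A diagonal element of a unital algebra $A$ is an $M\in A\otimes A$ such that $a\cdot M=M\cdot a$ for all $a\in A$ and such that multiplication $A\otimes A\to A$ maps $M$ to $1_A$. The algebra $\mathrm{Z}\ell^1(G)$ has a unique diagonal element; its norm in the projective tensor product $\mathrm{Z}\ell^1(G)\mathbin{\widehat\otimes}\mathrm{Z}\ell^1(G)$ is the ZL-amenability constant $\mathrm{AM}_{\mathrm Z}(G)$. A finite group has two character degrees if it is non-abelian and all its non-linear irreducible complex characters have the same degree. Let $q\ge 5$ be an odd prime power, let $\mathbb F_q$ be a field with $q$ elements, and let $G_q=\left\{\begin{pmatrix}a^2&b\\0&1\end{pmatrix}: a\in\mathbb F_q^\times,\ b\in\mathbb F_q\right\}$, a subgroup of the affine group $\mathrm{Aff}(\mathbb F_q)$. Then $G_q$ has two character degrees and $$\mathrm{AM}_{\mathrm Z}(G_q)=1+\frac{q+1}{2}\left(1-\frac{9}{q^2}\right).$$ Consequently, the ZL-amenability constants of finite groups with two character degrees are unbounded: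 for every real $C$ there is a finite group $G$ with two character degrees and $\mathrm{AM}_{\mathrm Z}(G)>C$. -/

import Mathlib

open scoped TensorProduct

/-! ### Diagonal elements and amenability constants -/

/-- `M ∈ A ⊗ A` is a diagonal element (separability idempotent) of the unital algebra `A`:
`a · M = M · a` for all `a`, where `a · (b ⊗ c) = (a b) ⊗ c` and `(b ⊗ c) · a = b ⊗ (c a)`, and
the multiplication map sends `M` to `1`. -/
def IsDiagonalElement (A : Type*) [Ring A] [Algebra ℂ A] (M : A ⊗[ℂ] A) : Prop :=
  (∀ a : A, (a ⊗ₜ[ℂ] (1 : A)) * M = M * ((1 : A) ⊗ₜ[ℂ] a)) ∧ LinearMap.mul' ℂ A M = 1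

/-- A commutative algebra has at most one diagonal element. -/
theorem IsDiagonalElement.unique {A : Type*} [CommRing A] [Algebra ℂ A] {M M' : A ⊗[ℂ] A}
    (h : IsDiagonalElement A M) (h' : IsDiagonalElement A M') : M = M' := by
  have key : ∀ N : A ⊗[ℂ] A, IsDiagonalElement A N → ∀ t : A ⊗[ℂ] A,
      t * N = (LinearMap.mul' ℂ A t ⊗ₜ[ℂ] (1 : A)) * N := by
    intro N hN t
    induction t with
    | zero => simp
    | add x y hx hy => rw [add_mul, hx, hy, map_add, TensorProduct.add_tmul, add_mul]
    | tmul a b =>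
      have e1 : a ⊗ₜ[ℂ] b = (a ⊗ₜ[ℂ] (1 : A)) * ((1 : A) ⊗ₜ[ℂ] b) := by simp
      have e2 : LinearMap.mul' ℂ A (a ⊗ₜ[ℂ] b) ⊗ₜ[ℂ] (1 : A)
          = (a ⊗ₜ[ℂ] (1 : A)) * (b ⊗ₜ[ℂ] (1 : A)) := by simp
      rw [e2, e1, mul_assoc, mul_assoc, hN.1 b, mul_comm N]
  have h1 := key M h M'
  have h2 := key M' h' M
  rw [h'.2, ← Algebra.TensorProduct.one_def, one_mul] at h1
  rw [h.2, ← Algebra.TensorProduct.one_def, one_mul] at h2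
  rw [← h1, mul_comm, h2]

/-- The projective tensor norm on `V ⊗ V`, where `V` is normed by `N`: the infimum of
`∑ i, N (a i) * N (b i)` over all representations `x = ∑ i, a i ⊗ b i`. -/
noncomputable def projectiveTensorNorm {V : Type*} [AddCommGroup V] [Module ℂ V] (N : V → ℝ)
    (x : V ⊗[ℂ] V) : ℝ :=
  sInf {r : ℝ | ∃ (n : ℕ) (a b : Fin n → V),
    x = ∑ i, a i ⊗ₜ[ℂ] b i ∧ r = ∑ i, N (a i) * N (b i)}

/-- The amenability constant of a finite-dimensional algebra `A` normed by `N`: the infimum of the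
projective tensor norms of its diagonal elements. (When `A` is commutative there is at most one
diagonal element, so for an amenable `A` this is the norm of the unique diagonal element.) -/
noncomputable def amenabilityConstant (A : Type*) [Ring A] [Algebra ℂ A] (N : A → ℝ) : ℝ :=
  sInf {r : ℝ | ∃ M : A ⊗[ℂ] A, IsDiagonalElement A M ∧ r = projectiveTensorNorm N M}

/-! ### The ZL-amenability constant of a finite group -/

/-- The `ℓ¹`-norm `∑ g, ‖f g‖` on the group algebra, `G` carrying counting measure. -/
noncomputable def l1Norm {G : Type*} [Group G] (f : MonoidAlgebra ℂ G) : ℝ :=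
  f.coeff.sum fun _ c => ‖c‖

/-- The ZL-amenability constant of a finite group `G`: the amenability constant of the centre of
the group algebra `ℓ¹(G)`, with the `ℓ¹`-norm. -/
noncomputable def zlAmenabilityConstant (G : Type*) [Group G] [Finite G] : ℝ :=
  amenabilityConstant (Subalgebra.center ℂ (MonoidAlgebra ℂ G)) fun f => l1Norm f.1

/-! ### Groups with two character degrees -/

/-- `χ` is a complex irreducible character of the finite group `G`, that is, the character of an
irreducible representation on some `ℂⁿ`. -/
def IsIrreducibleCharacter {G : Type*} [Group G] (χ : G → ℂ) : Prop :=
  ∃ (n : ℕ) (ρ : Representation ℂ G (Fin n → ℂ)), ρ.IsIrreducible ∧ χ = ρ.character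

/-- A character is linear if it is a homomorphism from `G` to the circle group. -/
def IsLinearCharacter {G : Type*} [Group G] (χ : G → ℂ) : Prop :=
  ∃ φ : G →* Circle, ∀ g, χ g = (φ g : ℂ)

/-- `G` has two character degrees: it is non-abelian, and all non-linear irreducible characters
have the same degree `χ 1`. -/
def HasTwoCharacterDegrees (G : Type*) [Group G] : Prop :=
  (∃ a b : G, a * b ≠ b * a) ∧
    ∀ χ ψ : G → ℂ, IsIrreducibleCharacter χ → IsIrreducibleCharacter ψ →
      ¬ IsLinearCharacter χ → ¬ IsLinearCharacter ψ → χ 1 = ψ 1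

/-! ### Affine groups -/

/-- The affine group of the field `F`: the matrices `(a b; 0 1)` with `a ≠ 0`. -/
def affineGroup (F : Type*) [Field F] : Subgroup (GL (Fin 2) F) where
  carrier := {g | ∃ (a : Fˣ) (b : F), (g : Matrix (Fin 2) (Fin 2) F) = !![(a : F), b; 0, 1]}
  one_mem' := ⟨1, 0, by simp [Matrix.one_fin_two]⟩
  mul_mem' := by
    rintro g h ⟨a, b, hg⟩ ⟨c, d, hh⟩
    refine ⟨a * c, a * d + b, ?_⟩
    rw [Units.val_mul, hg, hh, Matrix.mul_fin_two]
    simp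
  inv_mem' := by
    rintro g ⟨a, b, hg⟩
    refine ⟨a⁻¹, -((a⁻¹ : Fˣ) : F) * b, ?_⟩
    refine Units.inv_eq_of_mul_eq_one_right ?_
    rw [hg, Matrix.mul_fin_two, Matrix.one_fin_two]
    simp

/-- The `a²x + b` group over `F`: the matrices `(a² b; 0 1)` with `a ≠ 0`, as a subgroup of the
affine group. -/
def squareAffineGroup (F : Type*) [Field F] : Subgroup (affineGroup F) where
  carrier := {g | ∃ (a : Fˣ) (b : F),
    ((g : GL (Fin 2) F) : Matrix (Fin 2) (Fin 2) F) = !![(a : F) ^ 2, b; 0, 1]}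
  one_mem' := ⟨1, 0, by simp [Matrix.one_fin_two]⟩
  mul_mem' := by
    rintro g h ⟨a, b, hg⟩ ⟨c, d, hh⟩
    refine ⟨a * c, (a : F) ^ 2 * d + b, ?_⟩
    rw [Subgroup.coe_mul, Units.val_mul, hg, hh, Matrix.mul_fin_two]
    simp [mul_pow]
  inv_mem' := by
    rintro g ⟨a, b, hg⟩
    refine ⟨a⁻¹, -((a⁻¹ : Fˣ) : F) ^ 2 * b, ?_⟩
    rw [Subgroup.coe_inv]
    refine Units.inv_eq_of_mul_eq_one_right ?_
    rw [hg, Matrix.mul_fin_two, Matrix.one_fin_two]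
    simp [← mul_assoc]

/-! Write $S$ for the group of nonzero squares, $m=(q-1)/2$ for its order and $\chi$ for the
quadratic character, so that $G_q=\mathbb F_q\rtimes S$. The conjugacy classes are the identity, the
translations by nonzero squares, those by non-squares, and one full coset of the translations for
each $s\ne1$ in $S$. Hence the centre is spanned by the coset sums $u_s$, the unit and
$d=\sum_b\chi(b)\,b$ (`center_eq_combination`). With $e=1-q^{-1}u_1$ the relations are
$u_su_t=q\,u_{st}$, $u_sd=0$ and $d^2=\chi(-1)q\,e$; the last is a Jacobi sum
(`quadraticSum_mul_self`). The centre therefore splits as $\mathbb C[S]$ times a two-dimensional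
algebra with unit $e$, and the diagonal element can be written down
(`isDiagonalElement_of_relations`).

Its projective norm is the sum of the absolute values of its coefficients on $G\times G$
(`projectiveTensorNorm_center`). The part from $\mathbb C[S]$ alone has norm 1. The growth comes
from the pairs of nontrivial translations: $(q-1)^2$ coefficients of mean absolute value $1/(2q)$,
hence a norm of order $q/2$.

For the degrees, an irreducible representation trivial on translations factors through the abelian
group $S$. Otherwise a nontrivial character of $\mathbb F_q$ occurs, its $S$-orbit has $m$ elements,
and the dimension is $m$ (`finrank_eq_card_unitSquares`). -/

/-! ### Coordinates on the `a²x + b` group -/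

/-- The group of nonzero squares of a field. -/
abbrev UnitSquares (F : Type*) [Field F] : Subgroup Fˣ := (powMonoidHom 2 : Fˣ →* Fˣ).range

section Coordinates

variable {F : Type*} [Field F]

/-- The matrix `(s b; 0 1)` as an element of the `a²x + b` group. -/
noncomputable def sqAff (s : UnitSquares F) (b : F) : squareAffineGroup F :=
  ⟨⟨Matrix.GeneralLinearGroup.mkOfDetNeZero !![((s : Fˣ) : F), b; 0, 1] (by simp),
    s, b, rfl⟩, by
      obtain ⟨s, a, rfl⟩ := s
      exact ⟨a, b, by simp [Matrix.GeneralLinearGroup.mkOfDetNeZero]⟩⟩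

theorem coe_sqAff (s : UnitSquares F) (b : F) :
    (((sqAff s b : affineGroup F) : GL (Fin 2) F) : Matrix (Fin 2) (Fin 2) F)
      = !![((s : Fˣ) : F), b; 0, 1] := rfl

theorem squareAffineGroup_ext {g h : squareAffineGroup F}
    (H : (((g : affineGroup F) : GL (Fin 2) F) : Matrix (Fin 2) (Fin 2) F) =
      (((h : affineGroup F) : GL (Fin 2) F) : Matrix (Fin 2) (Fin 2) F)) : g = h :=
  Subtype.ext (Subtype.ext (Units.ext H))

theorem sqAff_inj {s t : UnitSquares F} {b c : F} : sqAff s b = sqAff t c ↔ s = t ∧ b = c := by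
  refine ⟨fun h => ?_, fun h => by rw [h.1, h.2]⟩
  have h' := congrArg (fun g : squareAffineGroup F =>
    (((g : affineGroup F) : GL (Fin 2) F) : Matrix (Fin 2) (Fin 2) F)) h
  simp only [coe_sqAff] at h'
  have h1 := congrFun (congrFun h' 0) 0
  have h2 := congrFun (congrFun h' 0) 1
  simp at h1 h2
  exact ⟨Subtype.ext (Units.ext h1), h2⟩

theorem sqAff_mul (s t : UnitSquares F) (b c : F) :
    sqAff s b * sqAff t c = sqAff (s * t) (((s : Fˣ) : F) * c + b) := by
  apply squareAffineGroup_ext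
  rw [Subgroup.coe_mul, Subgroup.coe_mul, Units.val_mul, coe_sqAff, coe_sqAff, coe_sqAff,
    Matrix.mul_fin_two]
  simp

theorem sqAff_one : sqAff (1 : UnitSquares F) 0 = 1 := by
  apply squareAffineGroup_ext
  rw [coe_sqAff]
  simp [Matrix.one_fin_two]

theorem sqAff_surjective (g : squareAffineGroup F) : ∃ s b, g = sqAff s b := by
  obtain ⟨a, b, h⟩ := g.2
  refine ⟨⟨a ^ 2, a, rfl⟩, b, squareAffineGroup_ext ?_⟩
  rw [h, coe_sqAff]
  simp

/-- The `a²x + b` group is parametrized by pairs of a nonzero square and an element. -/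
noncomputable def sqAffEquiv (F : Type*) [Field F] : UnitSquares F × F ≃ squareAffineGroup F :=
  Equiv.ofBijective (fun p => sqAff p.1 p.2)
    ⟨fun p p' h => Prod.ext (sqAff_inj.1 h).1 (sqAff_inj.1 h).2,
      fun g => by obtain ⟨s, b, rfl⟩ := sqAff_surjective g; exact ⟨(s, b), rfl⟩⟩

@[simp] theorem sqAffEquiv_apply (p : UnitSquares F × F) :
    sqAffEquiv F p = sqAff p.1 p.2 := rfl

theorem quadraticChar_unitSquares [Fintype F] [DecidableEq F] (s : UnitSquares F) :
    quadraticChar F ((s : Fˣ) : F) = 1 := by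
  obtain ⟨s, a, rfl⟩ := s
  simpa using quadraticChar_sq_one' a.ne_zero

/-- Squaring on $F^\times$ has kernel $\{1,-1\}$, of order two in odd characteristic. -/
theorem card_unitSquares [Fintype F] (hF : ringChar F ≠ 2) :
    2 * Nat.card (UnitSquares F) + 1 = Nat.card F := by
  classical
  have hker : Nat.card (powMonoidHom 2 : Fˣ →* Fˣ).ker = 2 := by
    have hset : ((powMonoidHom 2 : Fˣ →* Fˣ).ker : Set Fˣ) = {1, -1} := by
      ext a
      simp only [SetLike.mem_coe, MonoidHom.mem_ker, powMonoidHom_apply, Set.mem_insert_iff,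
        Set.mem_singleton_iff, Units.ext_iff]
      simp
    have hne : (1 : Fˣ) ≠ -1 := fun h =>
      Ring.neg_one_ne_one_of_char_ne_two hF (by simpa using (congrArg Units.val h).symm)
    rw [← SetLike.coe_sort_coe, hset, Nat.card_coe_set_eq, Set.ncard_pair hne]
  have h := Subgroup.card_eq_card_quotient_mul_card_subgroup (powMonoidHom 2 : Fˣ →* Fˣ).ker
  rw [Nat.card_congr (QuotientGroup.quotientKerEquivRange _).toEquiv, hker,
    Nat.card_eq_fintype_card (α := Fˣ), Fintype.card_units] at h
  have := Fintype.card_pos (α := F)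
  rw [Nat.card_eq_fintype_card (α := F)]
  change _ = Nat.card (UnitSquares F) * 2 at h
  omega

end Coordinates

/-! ### The projective norm on the centre of the group algebra -/

section ProjectiveNorm

variable {G : Type*} [Group G]

theorem l1Norm_eq_sum [Fintype G] (f : MonoidAlgebra ℂ G) : l1Norm f = ∑ g, ‖f.coeff g‖ :=
  Finsupp.sum_fintype _ _ (by simp)

theorem l1Norm_nonneg (f : MonoidAlgebra ℂ G) : 0 ≤ l1Norm f :=
  Finset.sum_nonneg fun _ _ => norm_nonneg _

/-- The `g`-th coefficient of a central element. -/
noncomputable def centerCoeff (g : G) :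
    Subalgebra.center ℂ (MonoidAlgebra ℂ G) →ₗ[ℂ] ℂ where
  toFun f := f.1.coeff g
  map_add' _ _ := rfl
  map_smul' _ _ := rfl

theorem centerCoeff_apply (g : G) (f : Subalgebra.center ℂ (MonoidAlgebra ℂ G)) :
    centerCoeff g f = f.1.coeff g := rfl

/-- The coefficient at `(g, h)` of an element of the tensor square of the centre. -/
noncomputable def tensorCoeff (g h : G) :
    Subalgebra.center ℂ (MonoidAlgebra ℂ G) ⊗[ℂ] Subalgebra.center ℂ (MonoidAlgebra ℂ G)
      →ₗ[ℂ] ℂ :=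
  LinearMap.mul' ℂ ℂ ∘ₗ TensorProduct.map (centerCoeff g) (centerCoeff h)

@[simp] theorem tensorCoeff_tmul (g h : G) (a b : Subalgebra.center ℂ (MonoidAlgebra ℂ G)) :
    tensorCoeff g h (a ⊗ₜ b) = a.1.coeff g * b.1.coeff h := by
  simp [tensorCoeff, centerCoeff_apply]

theorem mem_center_monoidAlgebra {f : MonoidAlgebra ℂ G} :
    f ∈ Subalgebra.center ℂ (MonoidAlgebra ℂ G) ↔
      ∀ g : G, MonoidAlgebra.single g 1 * f = f * MonoidAlgebra.single g 1 := by
  rw [Subalgebra.mem_center_iff]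
  refine ⟨fun h g => h _, fun h a => ?_⟩
  induction a using MonoidAlgebra.induction_linear with
  | zero => simp
  | add x y hx hy => rw [add_mul, mul_add, hx, hy]
  | single g r =>
    have : MonoidAlgebra.single g r = r • (MonoidAlgebra.single g 1 : MonoidAlgebra ℂ G) := by
      simp
    rw [this, smul_mul_assoc, h g, mul_smul_comm]

variable [Fintype G]

/-- The average of the conjugates of `g`, as an element of the centre of the group algebra. -/
noncomputable def conjAverage (g : G) : Subalgebra.center ℂ (MonoidAlgebra ℂ G) :=
  ⟨(Fintype.card G : ℂ)⁻¹ • ∑ x : G, MonoidAlgebra.single (x * g * x⁻¹) 1, by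
    rw [mem_center_monoidAlgebra]
    intro y
    rw [mul_smul_comm, smul_mul_assoc, Finset.mul_sum, Finset.sum_mul]
    congr 1
    refine Fintype.sum_equiv (Equiv.mulLeft y) _ _ fun x => ?_
    simp [MonoidAlgebra.single_mul_single, mul_assoc]⟩

theorem l1Norm_conjAverage_le (g : G) : l1Norm (conjAverage g).1 ≤ 1 := by
  classical
  have h0 : (Fintype.card G : ℝ) ≠ 0 := Nat.cast_ne_zero.2 Fintype.card_ne_zero
  rw [l1Norm_eq_sum]
  calc ∑ y, ‖(conjAverage g).1.coeff y‖
      ≤ ∑ y, (Fintype.card G : ℝ)⁻¹ * ∑ x : G, if x * g * x⁻¹ = y then 1 else 0 := by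
        refine Finset.sum_le_sum fun y _ => ?_
        simp only [conjAverage, MonoidAlgebra.coeff_smul, MonoidAlgebra.coeff_sum,
          MonoidAlgebra.coeff_single, Finsupp.smul_apply, Finsupp.finsetSum_apply, norm_smul,
          norm_inv, Complex.norm_natCast]
        refine mul_le_mul_of_nonneg_left ((norm_sum_le _ _).trans
          (Finset.sum_le_sum fun x _ => ?_)) (by positivity)
        rw [Finsupp.single_apply]
        split_ifs <;> simp
    _ = 1 := by
        rw [← Finset.mul_sum, Finset.sum_comm]
        simp [h0]

/-- Conjugation by any $x$ fixes a central $f$; averaging over $x$ the conjugated expansion of $f$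
replaces each group element by its conjugate average. -/
theorem center_eq_sum_conjAverage (f : Subalgebra.center ℂ (MonoidAlgebra ℂ G)) :
    f = ∑ g, centerCoeff g f • conjAverage g := by
  classical
  have h0 : (Fintype.card G : ℂ) ≠ 0 := Nat.cast_ne_zero.2 Fintype.card_ne_zero
  have hf := mem_center_monoidAlgebra.1 f.2
  have key : ∀ x : G, ∑ g, f.1.coeff g • (MonoidAlgebra.single (x * g * x⁻¹) 1 : MonoidAlgebra ℂ G)
      = f.1 := by
    intro x
    calc ∑ g, f.1.coeff g • (MonoidAlgebra.single (x * g * x⁻¹) 1 : MonoidAlgebra ℂ G)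
        = MonoidAlgebra.single x 1 * (∑ g, MonoidAlgebra.single g (f.1.coeff g))
            * MonoidAlgebra.single x⁻¹ 1 := by
          simp [Finset.mul_sum, Finset.sum_mul, MonoidAlgebra.single_mul_single]
      _ = MonoidAlgebra.single x 1 * f.1 * MonoidAlgebra.single x⁻¹ 1 := by
          congr 2
          exact (Finsupp.sum_fintype _ _ (by simp)).symm.trans (MonoidAlgebra.sum_coeff_single f.1)
      _ = f.1 := by
          rw [hf x, mul_assoc, MonoidAlgebra.single_mul_single, mul_inv_cancel, one_mul,
            ← MonoidAlgebra.one_def, mul_one]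
  apply Subtype.ext
  rw [AddSubmonoidClass.coe_finsetSum]
  simp only [conjAverage, Subalgebra.coe_smul, centerCoeff_apply]
  simp_rw [smul_comm (_ : ℂ) (Fintype.card G : ℂ)⁻¹, ← Finset.smul_sum]
  rw [eq_inv_smul_iff₀ h0]
  simp_rw [Finset.smul_sum]
  rw [Finset.sum_comm]
  rw [Finset.sum_congr rfl fun x _ => key x]
  simp [Nat.cast_smul_eq_nsmul]

theorem tensor_eq_sum_conjAverage
    (M : Subalgebra.center ℂ (MonoidAlgebra ℂ G) ⊗[ℂ] Subalgebra.center ℂ (MonoidAlgebra ℂ G)) :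
    M = ∑ p : G × G, (tensorCoeff p.1 p.2 M • conjAverage p.1) ⊗ₜ[ℂ] conjAverage p.2 := by
  induction M with
  | zero => simp
  | add x y hx hy =>
    simp only [map_add, add_smul, TensorProduct.add_tmul, Finset.sum_add_distrib]
    rw [← hx, ← hy]
  | tmul a b =>
    conv_lhs => rw [center_eq_sum_conjAverage a, center_eq_sum_conjAverage b]
    rw [TensorProduct.sum_tmul, Fintype.sum_prod_type]
    refine Finset.sum_congr rfl fun g _ => ?_
    rw [TensorProduct.tmul_sum]
    refine Finset.sum_congr rfl fun h _ => ?_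
    rw [tensorCoeff_tmul, TensorProduct.tmul_smul, ← TensorProduct.smul_tmul', smul_smul,
      TensorProduct.smul_tmul', mul_comm]
    rfl

/-- On the centre of a finite group algebra the projective tensor norm is the `ℓ¹`-norm of the
array of coefficients. -/
theorem projectiveTensorNorm_center
    (M : Subalgebra.center ℂ (MonoidAlgebra ℂ G) ⊗[ℂ] Subalgebra.center ℂ (MonoidAlgebra ℂ G)) :
    projectiveTensorNorm (fun f : Subalgebra.center ℂ (MonoidAlgebra ℂ G) => l1Norm f.1) M
      = ∑ p : G × G, ‖tensorCoeff p.1 p.2 M‖ := by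
  -- Lower bound: apply the triangle inequality to each coefficient of an arbitrary representation.
  have lower : ∀ r ∈ {r : ℝ | ∃ (n : ℕ) (a b : Fin n → Subalgebra.center ℂ (MonoidAlgebra ℂ G)),
      M = ∑ i, a i ⊗ₜ[ℂ] b i ∧ r = ∑ i, l1Norm (a i).1 * l1Norm (b i).1},
      ∑ p : G × G, ‖tensorCoeff p.1 p.2 M‖ ≤ r := by
    rintro _ ⟨n, a, b, rfl, rfl⟩
    calc ∑ p : G × G, ‖tensorCoeff p.1 p.2 (∑ i, a i ⊗ₜ[ℂ] b i)‖
        ≤ ∑ p : G × G, ∑ i, ‖(a i).1.coeff p.1‖ * ‖(b i).1.coeff p.2‖ := by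
          refine Finset.sum_le_sum fun p _ => ?_
          rw [map_sum]
          refine (norm_sum_le _ _).trans (le_of_eq ?_)
          simp
      _ = ∑ i, l1Norm (a i).1 * l1Norm (b i).1 := by
          rw [Finset.sum_comm]
          refine Finset.sum_congr rfl fun i _ => ?_
          rw [l1Norm_eq_sum, l1Norm_eq_sum, Finset.sum_mul_sum, Fintype.sum_prod_type]
  obtain ⟨n, ⟨e⟩⟩ := Finite.exists_equiv_fin (G × G)
  -- Upper bound: expand in the tensors of conjugate averages, whose factors have norm at most one.
  have hmem : ∃ r ∈ {r : ℝ | ∃ (n : ℕ) (a b : Fin n → Subalgebra.center ℂ (MonoidAlgebra ℂ G)),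
      M = ∑ i, a i ⊗ₜ[ℂ] b i ∧ r = ∑ i, l1Norm (a i).1 * l1Norm (b i).1},
      r ≤ ∑ p : G × G, ‖tensorCoeff p.1 p.2 M‖ := by
    refine ⟨_, ⟨n, fun i => tensorCoeff (e.symm i).1 (e.symm i).2 M • conjAverage (e.symm i).1,
      fun i => conjAverage (e.symm i).2, ?_, rfl⟩, ?_⟩
    · conv_lhs => rw [tensor_eq_sum_conjAverage M]
      exact Fintype.sum_equiv e _ _ fun p => by simp
    · rw [← Equiv.sum_comp e]
      refine Finset.sum_le_sum fun p _ => ?_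
      beta_reduce
      rw [e.symm_apply_apply]
      have h1 : l1Norm (tensorCoeff p.1 p.2 M • conjAverage p.1).1
          = ‖tensorCoeff p.1 p.2 M‖ * l1Norm (conjAverage p.1).1 := by
        rw [l1Norm_eq_sum, l1Norm_eq_sum, Finset.mul_sum]
        exact Finset.sum_congr rfl fun g _ => by
          rw [Subalgebra.coe_smul, MonoidAlgebra.coeff_smul_apply, norm_smul]
      rw [h1, mul_assoc]
      exact mul_le_of_le_one_right (norm_nonneg _)
        (mul_le_one₀ (l1Norm_conjAverage_le _) (l1Norm_nonneg _) (l1Norm_conjAverage_le _))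
  obtain ⟨r, hr, hle⟩ := hmem
  exact le_antisymm ((csInf_le ⟨_, lower⟩ hr).trans hle) (le_csInf ⟨r, hr⟩ lower)

/-- By uniqueness of the diagonal element, the infimum defining the constant runs over a single
value. -/
theorem zlAmenabilityConstant_eq_sum
    {M : Subalgebra.center ℂ (MonoidAlgebra ℂ G) ⊗[ℂ] Subalgebra.center ℂ (MonoidAlgebra ℂ G)}
    (hM : IsDiagonalElement _ M) :
    zlAmenabilityConstant G = ∑ p : G × G, ‖tensorCoeff p.1 p.2 M‖ := by
  rw [← projectiveTensorNorm_center, zlAmenabilityConstant, amenabilityConstant]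
  have hset : {r : ℝ | ∃ M' : Subalgebra.center ℂ (MonoidAlgebra ℂ G) ⊗[ℂ]
      Subalgebra.center ℂ (MonoidAlgebra ℂ G), IsDiagonalElement _ M' ∧
        r = projectiveTensorNorm (fun f => l1Norm f.1) M'}
      = {projectiveTensorNorm (fun f => l1Norm f.1) M} := by
    ext r
    refine ⟨?_, fun h => ⟨M, hM, h⟩⟩
    rintro ⟨M', hM', rfl⟩
    rw [hM'.unique hM]
    rfl
  rw [hset, csInf_singleton]

end ProjectiveNorm

/-! ### The diagonal element -/

/-- The diagonal element of a commutative algebra spanned by the unit, a family `u` that multiplies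
like a group up to a scalar `q`, and an element `d` annihilated by `u` whose square is a multiple of
the idempotent `1 - q⁻¹ u`. -/
theorem isDiagonalElement_of_relations {A S : Type*} [CommRing A] [Algebra ℂ A] [CommGroup S]
    [Fintype S] (u : S → A) (d e : A) {q Q : ℂ} (hq : q ≠ 0) (hQ : Q ≠ 0)
    (huu : ∀ s t, u s * u t = q • u (s * t)) (hud : ∀ s, u s * d = 0)
    (he : e = 1 - q⁻¹ • u 1) (hdd : d * d = Q • e)
    (hspan : ∀ a : A, ∃ (c : S → ℂ) (x y : ℂ), a = ∑ s, c s • u s + x • 1 + y • d) :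
    IsDiagonalElement A (((Fintype.card S : ℂ) * q ^ 2)⁻¹ • ∑ s, u s ⊗ₜ[ℂ] u s⁻¹
      + (1 / 2 : ℂ) • (e ⊗ₜ[ℂ] e + Q⁻¹ • d ⊗ₜ[ℂ] d)) := by
  have hm : (Fintype.card S : ℂ) ≠ 0 := Nat.cast_ne_zero.2 Fintype.card_ne_zero
  have hue : ∀ s, u s * e = 0 := fun s => by
    rw [he, mul_sub, mul_one, mul_smul_comm, huu, mul_one, smul_smul, inv_mul_cancel₀ hq,
      one_smul, sub_self]
  have hde : d * e = d := by
    rw [he, mul_sub, mul_one, mul_smul_comm, mul_comm d, hud, smul_zero, sub_zero]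
  have hee : e * e = e := by
    conv_lhs => enter [1]; rw [he]
    rw [sub_mul, one_mul, smul_mul_assoc, hue, smul_zero, sub_zero]
  refine ⟨fun a => ?_, ?_⟩
  · obtain ⟨c, x, y, rfl⟩ := hspan a
    set M := ((Fintype.card S : ℂ) * q ^ 2)⁻¹ • ∑ s, u s ⊗ₜ[ℂ] u s⁻¹
      + (1 / 2 : ℂ) • (e ⊗ₜ[ℂ] e + Q⁻¹ • d ⊗ₜ[ℂ] d) with hM
    -- Both sides reduce to a sum over $S$, matched by $s\mapsto ts$; the terms in `e` and `d` are
    -- killed by `u t`.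
    have h1 : ∀ t, (u t ⊗ₜ[ℂ] (1 : A)) * M = M * ((1 : A) ⊗ₜ[ℂ] u t) := fun t => by
      rw [hM, mul_add, add_mul, mul_smul_comm, mul_smul_comm, smul_mul_assoc, smul_mul_assoc,
        mul_add, add_mul, mul_smul_comm, smul_mul_assoc, Finset.mul_sum, Finset.sum_mul]
      simp only [Algebra.TensorProduct.tmul_mul_tmul, one_mul, mul_one, huu, hue, hud,
        mul_comm e, mul_comm d, TensorProduct.zero_tmul, TensorProduct.tmul_zero]
      congr 2
      refine Fintype.sum_equiv (Equiv.mulLeft t) _ _ fun s => ?_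
      simp [TensorProduct.smul_tmul']
    have h2 : (d ⊗ₜ[ℂ] (1 : A)) * M = M * ((1 : A) ⊗ₜ[ℂ] d) := by
      rw [hM, mul_add, add_mul, mul_smul_comm, mul_smul_comm, smul_mul_assoc, smul_mul_assoc,
        mul_add, add_mul, mul_smul_comm, smul_mul_assoc, Finset.mul_sum, Finset.sum_mul]
      simp only [Algebra.TensorProduct.tmul_mul_tmul, one_mul, mul_one, hud, mul_comm d (u _), hde,
        mul_comm e d, hdd, TensorProduct.zero_tmul, TensorProduct.tmul_zero]
      simp only [TensorProduct.tmul_smul, ← TensorProduct.smul_tmul', smul_smul,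
        inv_mul_cancel₀ hQ, one_smul]
      rw [add_comm (d ⊗ₜ[ℂ] e)]
    simp only [TensorProduct.add_tmul, TensorProduct.tmul_add, TensorProduct.sum_tmul,
      TensorProduct.tmul_sum, ← TensorProduct.smul_tmul', TensorProduct.tmul_smul, add_mul,
      mul_add, Finset.sum_mul, Finset.mul_sum, smul_mul_assoc, mul_smul_comm, h1, h2]
    rw [← Algebra.TensorProduct.one_def, one_mul, mul_one]
  · simp only [map_add, map_smul, map_sum, LinearMap.mul'_apply, huu, hee, hdd, mul_inv_cancel,
      Finset.sum_const, Finset.card_univ, smul_smul, inv_mul_cancel₀ hQ, one_smul,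
      ← Nat.cast_smul_eq_nsmul ℂ]
    -- The sum over `S` multiplies out to $q^{-1}u_1$, the other two terms to `e`, and these add up
    -- to 1.
    have h3 : ((Fintype.card S : ℂ) * q ^ 2)⁻¹ * (Fintype.card S * q) = q⁻¹ := by field_simp
    rw [h3, ← two_smul ℂ e, smul_smul, he]
    norm_num

theorem one_coeff {F : Type*} [Field F] [DecidableEq F] [DecidableEq (UnitSquares F)]
    (t : UnitSquares F) (b : F) :
    (1 : MonoidAlgebra ℂ (squareAffineGroup F)).coeff (sqAff t b)
      = if t = 1 then if b = 0 then 1 else 0 else 0 := by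
  classical
  rw [MonoidAlgebra.one_def, MonoidAlgebra.coeff_single, ← sqAff_one]
  simp only [Finsupp.single_apply, sqAff_inj]
  by_cases h : t = 1
  · simp [h, eq_comm]
  · simp [h, Ne.symm h]

section Centre

variable {F : Type*} [Field F] [Fintype F]

/-- The sum of the elements with linear part `s`. -/
noncomputable def cosetSum (s : UnitSquares F) :
    Subalgebra.center ℂ (MonoidAlgebra ℂ (squareAffineGroup F)) :=
  ⟨∑ b : F, MonoidAlgebra.single (sqAff s b) 1, by
    rw [mem_center_monoidAlgebra]
    intro g
    obtain ⟨t, c, rfl⟩ := sqAff_surjective g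
    rw [Finset.mul_sum, Finset.sum_mul]
    simp only [MonoidAlgebra.single_mul_single, sqAff_mul, one_mul]
    -- The substitution is $b\mapsto tb+c-sc$, obtained by equating $(t,c)(s,b)$ with $(s,b')(t,c)$.
    refine Fintype.sum_equiv (((Units.mulLeft (t : Fˣ)).trans (Equiv.addRight c)).trans
      (Equiv.subRight (((s : Fˣ) : F) * c))) _ _ fun b => ?_
    simp [mul_comm t s]⟩

theorem cosetSum_coeff [DecidableEq (UnitSquares F)] (s t : UnitSquares F) (b : F) :
    (cosetSum s).1.coeff (sqAff t b) = if t = s then 1 else 0 := by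
  classical
  simp only [cosetSum, MonoidAlgebra.coeff_sum, MonoidAlgebra.coeff_single,
    Finsupp.finsetSum_apply, Finsupp.single_apply, sqAff_inj]
  by_cases h : t = s
  · simp [h]
  · simp [h, Ne.symm h]

theorem cosetSum_mul (s t : UnitSquares F) :
    cosetSum s * cosetSum t = (Fintype.card F : ℂ) • cosetSum (s * t) := by
  apply Subtype.ext
  change (∑ b : F, MonoidAlgebra.single (sqAff s b) (1 : ℂ))
    * (∑ b : F, MonoidAlgebra.single (sqAff t b) (1 : ℂ))
    = (Fintype.card F : ℂ) • ∑ b : F, MonoidAlgebra.single (sqAff (s * t) b) (1 : ℂ)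
  rw [Finset.sum_mul_sum, Finset.sum_comm]
  simp only [MonoidAlgebra.single_mul_single, sqAff_mul, one_mul]
  have h : ∀ b : F, ∑ x, MonoidAlgebra.single (sqAff (s * t) (((s : Fˣ) : F) * b + x)) (1 : ℂ)
      = ∑ c, MonoidAlgebra.single (sqAff (s * t) c) 1 := fun b =>
    Equiv.sum_comp (Equiv.addLeft (((s : Fˣ) : F) * b))
      fun c => MonoidAlgebra.single (sqAff (s * t) c) (1 : ℂ)
  simp only [h]
  rw [Finset.sum_const, Finset.card_univ, Nat.cast_smul_eq_nsmul]

variable [DecidableEq F]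

/-- The difference of the two conjugacy class sums of nontrivial translations. -/
noncomputable def quadraticSum (F : Type*) [Field F] [Fintype F] [DecidableEq F] :
    Subalgebra.center ℂ (MonoidAlgebra ℂ (squareAffineGroup F)) :=
  ⟨∑ b : F, MonoidAlgebra.single (sqAff 1 b) (quadraticChar F b : ℂ), by
    rw [mem_center_monoidAlgebra]
    intro g
    obtain ⟨t, c, rfl⟩ := sqAff_surjective g
    rw [Finset.mul_sum, Finset.sum_mul]
    simp only [MonoidAlgebra.single_mul_single, sqAff_mul, one_mul, mul_one]
    refine Fintype.sum_equiv (Units.mulLeft (t : Fˣ)) _ _ fun b => ?_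
    -- Conjugation multiplies a translation by a square, which leaves $\chi$ unchanged.
    have hb : quadraticChar F (((t : Fˣ) : F) * b) = quadraticChar F b := by
      rw [map_mul, quadraticChar_unitSquares, one_mul]
    simp only [Units.mulLeft_apply, hb, OneMemClass.coe_one, Units.val_one, one_mul]
    rw [add_comm]⟩

theorem quadraticSum_coeff [DecidableEq (UnitSquares F)] (t : UnitSquares F) (b : F) :
    (quadraticSum F).1.coeff (sqAff t b) = if t = 1 then (quadraticChar F b : ℂ) else 0 := by
  classical
  simp only [quadraticSum, MonoidAlgebra.coeff_sum, MonoidAlgebra.coeff_single,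
    Finsupp.finsetSum_apply, Finsupp.single_apply, sqAff_inj]
  by_cases h : t = 1
  · simp [h]
  · simp [h, Ne.symm h]

theorem sum_quadraticChar_complex (hF : ringChar F ≠ 2) :
    ∑ b : F, (quadraticChar F b : ℂ) = 0 := by
  exact_mod_cast congrArg (Int.cast : ℤ → ℂ) (quadraticChar_sum_zero hF)

/-- A coset sum absorbs translations, so only the total weight $\sum_b\chi(b)=0$ survives. -/
theorem cosetSum_mul_quadraticSum (hF : ringChar F ≠ 2) (s : UnitSquares F) :
    cosetSum s * quadraticSum F = 0 := by
  apply Subtype.ext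
  change (∑ b : F, MonoidAlgebra.single (sqAff s b) (1 : ℂ))
    * (∑ b : F, MonoidAlgebra.single (sqAff 1 b) (quadraticChar F b : ℂ)) = 0
  rw [Finset.sum_mul_sum, Finset.sum_comm]
  simp only [MonoidAlgebra.single_mul_single, sqAff_mul, one_mul, mul_one]
  have h : ∀ b : F, ∑ x, MonoidAlgebra.single (sqAff s (((s : Fˣ) : F) * b + x))
      (quadraticChar F b : ℂ)
      = ∑ c, MonoidAlgebra.single (sqAff s c) (quadraticChar F b : ℂ) := fun b =>
    Equiv.sum_comp (Equiv.addLeft (((s : Fˣ) : F) * b))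
      fun c => MonoidAlgebra.single (sqAff s c) (quadraticChar F b : ℂ)
  simp only [h]
  rw [Finset.sum_comm]
  refine Finset.sum_eq_zero fun c _ => ?_
  rw [← MonoidAlgebra.coeff_inj, MonoidAlgebra.coeff_sum]
  simp only [MonoidAlgebra.coeff_single]
  rw [← Finsupp.single_finsetSum, sum_quadraticChar_complex hF]
  simp

/-- For $c\ne0$ the substitution $b=cx$ gives the Jacobi sum $J(\chi,\chi)$, which equals
$-\chi(-1)$ because $\chi^{-1}=\chi$. For $c=0$ every term with $b\ne0$ is $\chi(-1)$. -/
theorem sum_quadraticChar_mul_sub (hF : ringChar F ≠ 2) (c : F) :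
    ∑ b : F, quadraticChar F b * quadraticChar F (c - b)
      = quadraticChar F (-1) * ((if c = 0 then Fintype.card F else 0) - 1) := by
  by_cases hc : c = 0
  · subst hc
    have h : ∀ b : F, quadraticChar F b * quadraticChar F (0 - b)
        = quadraticChar F (-1) * (1 - if b = 0 then 1 else 0) := by
      intro b
      have hb' : (0 - b) = -1 * b := by ring
      rw [hb', map_mul]
      by_cases hb : b = 0
      · simp [hb]
      · have := quadraticChar_sq_one hb
        simp only [hb, if_false]
        linear_combination quadraticChar F (-1) * this
    simp only [h]
    rw [← Finset.mul_sum, Finset.sum_sub_distrib]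
    simp
  · have hJ := jacobiSum_nontrivial_inv (quadraticChar_ne_one hF)
    rw [(quadraticChar_isQuadratic F).inv, jacobiSum] at hJ
    rw [← Fintype.sum_equiv (Equiv.mulLeft₀ c hc)
      (fun x => quadraticChar F x * quadraticChar F (1 - x)) _ ?_, hJ]
    · simp [hc]
    · intro x
      have h1 : c - c * x = c * (1 - x) := by ring
      have h2 := quadraticChar_sq_one hc
      change _ = quadraticChar F (c * x) * quadraticChar F (c - c * x)
      rw [h1, map_mul, map_mul]
      linear_combination (-quadraticChar F x * quadraticChar F (1 - x)) * h2

/-- The coefficient of the square at translation by $c$ is the additive self-convolution of $\chi$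
at $c$. -/
theorem quadraticSum_mul_self (hF : ringChar F ≠ 2) :
    quadraticSum F * quadraticSum F = ((quadraticChar F (-1) : ℂ) * Fintype.card F) •
      (1 - (Fintype.card F : ℂ)⁻¹ • cosetSum 1) := by
  classical
  have hq : (Fintype.card F : ℂ) ≠ 0 := Nat.cast_ne_zero.2 Fintype.card_ne_zero
  apply Subtype.ext
  have h1 : (quadraticSum F * quadraticSum F).1
      = ∑ c : F, MonoidAlgebra.single (sqAff 1 c)
        ((∑ b : F, quadraticChar F b * quadraticChar F (c - b) : ℤ) : ℂ) := by
    change (∑ b : F, MonoidAlgebra.single (sqAff 1 b) (quadraticChar F b : ℂ))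
      * (∑ b : F, MonoidAlgebra.single (sqAff 1 b) (quadraticChar F b : ℂ)) = _
    rw [Finset.sum_mul_sum]
    simp only [MonoidAlgebra.single_mul_single, sqAff_mul, mul_one]
    rw [Finset.sum_congr rfl fun b _ => Fintype.sum_equiv (Equiv.addRight b) _
      (fun c => MonoidAlgebra.single (sqAff 1 c)
        ((quadraticChar F b : ℂ) * quadraticChar F (c - b))) fun c => by simp]
    rw [Finset.sum_comm]
    refine Finset.sum_congr rfl fun c _ => ?_
    rw [← MonoidAlgebra.coeff_inj, MonoidAlgebra.coeff_sum]
    simp only [MonoidAlgebra.coeff_single]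
    rw [← Finsupp.single_finsetSum]
    push_cast
    rfl
  rw [h1]
  ext g
  obtain ⟨t, c, rfl⟩ := sqAff_surjective g
  have h2 : ((((quadraticChar F (-1) : ℂ) * Fintype.card F) •
      (1 - (Fintype.card F : ℂ)⁻¹ • cosetSum 1) :
        Subalgebra.center ℂ (MonoidAlgebra ℂ (squareAffineGroup F))).1).coeff (sqAff t c)
      = ((quadraticChar F (-1) : ℂ) * Fintype.card F) *
        ((1 : MonoidAlgebra ℂ (squareAffineGroup F)).coeff (sqAff t c)
          - (Fintype.card F : ℂ)⁻¹ * (cosetSum 1).1.coeff (sqAff t c)) := rfl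
  rw [h2, one_coeff, cosetSum_coeff]
  simp only [MonoidAlgebra.coeff_sum, MonoidAlgebra.coeff_single,
    Finsupp.finsetSum_apply, Finsupp.single_apply, sqAff_inj, sum_quadraticChar_mul_sub hF]
  by_cases ht : t = 1
  · subst ht
    by_cases hc : c = 0
    · simp [hc]; field_simp
    · simp [hc]
  · simp [ht, Ne.symm ht]

theorem coeff_mul_comm_of_mem_center {G : Type*} [Group G] {f : MonoidAlgebra ℂ G}
    (hf : f ∈ Subalgebra.center ℂ (MonoidAlgebra ℂ G)) (g h : G) :
    f.coeff (g * h) = f.coeff (h * g) := by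
  have := congrArg (fun x : MonoidAlgebra ℂ G => x.coeff (h * (g * h)))
    (mem_center_monoidAlgebra.1 hf h)
  simpa [MonoidAlgebra.coeff_single_mul_apply, MonoidAlgebra.coeff_mul_single_apply,
    mul_assoc] using this

/-- A central element is constant on conjugacy classes, and the spanning family separates exactly
these classes. -/
theorem center_eq_combination [Fintype (UnitSquares F)] (hF : ringChar F ≠ 2)
    (f : Subalgebra.center ℂ (MonoidAlgebra ℂ (squareAffineGroup F))) :
    ∃ (c : UnitSquares F → ℂ) (x y : ℂ),
      f = ∑ s, c s • cosetSum s + x • 1 + y • quadraticSum F := by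
  classical
  have hcomm := coeff_mul_comm_of_mem_center f.2
  obtain ⟨ν, hν⟩ := quadraticChar_exists_neg_one hF
  -- the coefficients on the conjugacy classes
  have hlin : ∀ (s : UnitSquares F) (b : F), s ≠ 1 →
      f.1.coeff (sqAff s b) = f.1.coeff (sqAff s 0) := by
    intro s b hs
    have h1 : (1 - ((s : Fˣ) : F)) ≠ 0 := fun h => hs (Subtype.ext (Units.ext (by
      simpa using (sub_eq_zero.1 h).symm)))
    have := hcomm (sqAff 1 (b / (1 - ((s : Fˣ) : F)))) (sqAff s (-((s : Fˣ) : F) *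
      (b / (1 - ((s : Fˣ) : F)))))
    rw [sqAff_mul, sqAff_mul] at this
    convert this using 3
    · simp
    · simp
      field_simp
      ring
    · simp
    · simp
  have htr : ∀ (s : UnitSquares F) (b : F),
      f.1.coeff (sqAff 1 (((s : Fˣ) : F) * b)) = f.1.coeff (sqAff 1 b) := by
    intro s b
    have := hcomm (sqAff s 0) (sqAff s⁻¹ b)
    simpa [sqAff_mul] using this
  have hpos : ∀ b : F, quadraticChar F b = 1 → f.1.coeff (sqAff 1 b) = f.1.coeff (sqAff 1 1) := by
    intro b hb
    have hb0 : b ≠ 0 := by rintro rfl; simp at hb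
    obtain ⟨a, rfl⟩ := (quadraticChar_one_iff_isSquare hb0).1 hb
    have ha : a ≠ 0 := by rintro rfl; simp at hb0
    have := htr ⟨Units.mk0 a ha ^ 2, _, rfl⟩ 1
    simpa [pow_two] using this
  have hneg : ∀ b : F, quadraticChar F b = -1 →
      f.1.coeff (sqAff 1 b) = f.1.coeff (sqAff 1 ν) := by
    intro b hb
    have hν0 : ν ≠ 0 := by rintro rfl; simp at hν
    have hb0 : b ≠ 0 := by rintro rfl; simp at hb
    -- A product of two non-squares is a square $a^2$, whence $b=(a/\nu)^2\nu$.
    have h1 : quadraticChar F (b * ν) = 1 := by rw [map_mul, hb, hν]; norm_num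
    obtain ⟨a, ha'⟩ := (quadraticChar_one_iff_isSquare (mul_ne_zero hb0 hν0)).1 h1
    have ha : a ≠ 0 := by
      rintro rfl
      exact mul_ne_zero hb0 hν0 (by simpa using ha')
    have := htr ⟨Units.mk0 (a / ν) (div_ne_zero ha hν0) ^ 2, _, rfl⟩ ν
    rw [← this]
    congr 2
    simp
    field_simp
    linear_combination ha'
  set α := f.1.coeff (sqAff 1 1)
  set β := f.1.coeff (sqAff 1 ν)
  -- On nonzero translations the coefficient is $(\alpha+\beta)/2+\chi(b)(\alpha-\beta)/2$; the
  -- multiple of 1 corrects the value at the identity.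
  refine ⟨fun s => if s = 1 then (α + β) / 2 else f.1.coeff (sqAff s 0),
    f.1.coeff (sqAff 1 0) - (α + β) / 2, (α - β) / 2, ?_⟩
  apply Subtype.ext
  ext g
  obtain ⟨t, b, rfl⟩ := sqAff_surjective g
  change _ = centerCoeff (sqAff t b) (_ + _ + _)
  rw [map_add, map_add, map_sum, map_smul, map_smul]
  simp only [map_smul, centerCoeff_apply, cosetSum_coeff, quadraticSum_coeff, smul_eq_mul,
    OneMemClass.coe_one, one_coeff, mul_ite, mul_one, mul_zero, Finset.sum_ite_eq,
    Finset.mem_univ, if_true]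
  by_cases ht : t = 1
  · subst ht
    by_cases hb : b = 0
    · simp [hb]
    · rcases quadraticChar_dichotomy hb with h | h
      · rw [hpos b h, h]
        simp [hb]
        ring
      · rw [hneg b h, h]
        simp [hb]
        ring
  · simp [ht, hlin t b ht]

end Centre

/-! ### Irreducible representations -/

section Irreducible

variable {G V : Type*} [Group G] [AddCommGroup V] [Module ℂ V] {ρ : Representation ℂ G V}

theorem Representation.IsIrreducible.eq_top (hρ : ρ.IsIrreducible) (W : Submodule ℂ V)
    (hW : ∀ g, ∀ v ∈ W, ρ g v ∈ W) (hne : W ≠ ⊥) : W = ⊤ := by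
  have := hρ
  rcases eq_bot_or_eq_top (⟨W, fun g v hv => hW g v hv⟩ : Subrepresentation ρ) with h | h
  · exact absurd (congrArg Subrepresentation.toSubmodule h) hne
  · exact congrArg Subrepresentation.toSubmodule h

theorem Representation.IsIrreducible.nontrivial_space (hρ : ρ.IsIrreducible) : Nontrivial V := by
  have := hρ
  by_contra hV
  rw [not_nontrivial_iff_subsingleton] at hV
  exact bot_ne_top (α := Subrepresentation ρ)
    (Subrepresentation.toSubmodule_injective (Subsingleton.elim _ _))

variable [FiniteDimensional ℂ V]

/-- An irreducible representation with commuting operators has a linear character. -/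
theorem Representation.IsIrreducible.isLinearCharacter [Finite G] (hρ : ρ.IsIrreducible)
    (hcomm : ∀ g h, ρ g * ρ h = ρ h * ρ g) : IsLinearCharacter ρ.character := by
  have := hρ.nontrivial_space
  -- Schur's argument: an eigenspace of one operator is stable under all the others that commute
  -- with it.
  have hscalar : ∀ g, ∃ μ : ℂ, ∀ v, ρ g v = μ • v := by
    intro g
    obtain ⟨μ, hμ⟩ := Module.End.exists_eigenvalue (ρ g)
    refine ⟨μ, fun v => ?_⟩
    have htop := hρ.eq_top (Module.End.eigenspace (ρ g) μ) (fun h v hv => by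
      rw [Module.End.mem_eigenspace_iff] at hv ⊢
      have := LinearMap.congr_fun (hcomm g h) v
      simp only [Module.End.mul_apply] at this
      rw [this, hv, map_smul]) hμ
    exact Module.End.mem_eigenspace_iff.1 (htop ▸ Submodule.mem_top)
  choose μ hμ using hscalar
  obtain ⟨v, hv⟩ := exists_ne (0 : V)
  have hspan : Submodule.span ℂ {v} = ⊤ := by
    refine hρ.eq_top _ (fun g w hw => ?_) (by simpa using hv)
    rw [hμ]
    exact Submodule.smul_mem _ _ hw
  have hrank : Module.finrank ℂ V = 1 := by
    rw [← finrank_top, ← hspan, finrank_span_singleton hv]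
  have hchar : ∀ g, ρ.character g = μ g := by
    intro g
    have : ρ g = μ g • LinearMap.id := LinearMap.ext fun w => by simp [hμ]
    rw [Representation.character, this, map_smul, LinearMap.trace_id, hrank]
    simp
  have hone : μ 1 = 1 := smul_left_injective ℂ hv (by simp [← hμ])
  have hmul : ∀ g h, μ (g * h) = μ g * μ h := fun g h => smul_left_injective ℂ hv (by
    simp only [← hμ, mul_smul, map_mul, Module.End.mul_apply])
  let φ : G →* ℂ := ⟨⟨μ, hone⟩, hmul⟩
  -- The values are roots of unity since the group is finite.
  have hnorm : ∀ g, ‖μ g‖ = 1 := fun g =>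
    Complex.norm_eq_one_of_pow_eq_one (n := Nat.card G)
      (by change φ g ^ _ = 1; rw [← map_pow, pow_card_eq_one', map_one]) Nat.card_pos.ne'
  exact ⟨⟨⟨fun g => ⟨μ g, mem_sphere_zero_iff_norm.2 (hnorm g)⟩, Circle.ext hone⟩,
    fun g h => Circle.ext (hmul g h)⟩, hchar⟩

end Irreducible

section TwoDegrees

variable {F : Type*} [Field F] [Fintype F]

theorem sqAff_eq_mul {F : Type*} [Field F] (s : UnitSquares F) (b : F) :
    sqAff s b = sqAff 1 b * sqAff s 0 := by
  simp [sqAff_mul]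

theorem sqAff_mul_translation {F : Type*} [Field F] (s : UnitSquares F) (b : F) :
    sqAff 1 b * sqAff s 0 = sqAff s 0 * sqAff 1 (((s⁻¹ : UnitSquares F) : Fˣ) * b) := by
  simp [sqAff_mul]

variable {V : Type*} [AddCommGroup V] [Module ℂ V]
  {ρ : Representation ℂ (squareAffineGroup F) V}

/-- An irreducible representation in which the translations act nontrivially has dimension the
number of nonzero squares. -/
theorem finrank_eq_card_unitSquares (hρ : ρ.IsIrreducible) {b₀ : F} {w : V}
    (hw : ρ (sqAff 1 b₀) w ≠ w) : Module.finrank ℂ V = Nat.card (UnitSquares F) := by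
  classical
  have hq : (Fintype.card F : ℂ) ≠ 0 := Nat.cast_ne_zero.2 Fintype.card_ne_zero
  set ψ := AddChar.FiniteField.primitiveChar_to_Complex F
  have hψ : ψ.IsPrimitive := AddChar.FiniteField.primitiveChar_to_Complex_isPrimitive F
  have hsum : ∀ c : F, ∑ b, ψ (b * c) = if c = 0 then (Fintype.card F : ℂ) else 0 := fun c => by
    rw [AddChar.sum_mulShift c hψ]
    split_ifs <;> simp
  have hT : ∀ b c : F, ∀ v, ρ (sqAff 1 b) (ρ (sqAff 1 c) v) = ρ (sqAff 1 (b + c)) v := by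
    intro b c v
    rw [← Module.End.mul_apply, ← map_mul, sqAff_mul]
    simp [add_comm]
  have hT0 : ∀ v, ρ (sqAff 1 0) v = v := fun v => by rw [sqAff_one, map_one]; rfl
  -- projections onto the eigenspaces of the translations
  let E : F → V → V := fun c v => ∑ b, ψ (-(b * c)) • ρ (sqAff 1 b) v
  have hE : ∀ c b v, ρ (sqAff 1 b) (E c v) = ψ (b * c) • E c v := by
    intro c b v
    simp only [E, map_sum, map_smul, hT, Finset.smul_sum, smul_smul]
    refine Fintype.sum_equiv (Equiv.addLeft b) _ _ fun x => ?_
    rw [← AddChar.map_add_eq_mul]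
    congr 2
    simp only [Equiv.coe_addLeft]
    ring
  have hEsum : ∑ c, E c w = (Fintype.card F : ℂ) • w := by
    simp only [E]
    rw [Finset.sum_comm]
    simp only [← Finset.sum_smul]
    have : ∀ b : F, ∑ c, ψ (-(b * c)) = if b = 0 then (Fintype.card F : ℂ) else 0 := by
      intro b
      have := hsum (-b)
      simpa [mul_comm] using this
    simp [this, hT0]
  -- If only the component at 0 survived, `w` would be fixed by every translation.
  have hc : ∃ c ≠ 0, E c w ≠ 0 := by
    by_contra! h
    rw [Finset.sum_eq_single 0 (fun c _ hc => h c hc) (by simp)] at hEsum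
    have h1 := hE 0 b₀ w
    rw [hEsum, mul_zero, AddChar.map_zero_eq_one, one_smul, map_smul] at h1
    exact hw (smul_right_injective V hq h1)
  obtain ⟨c, hc0, hv⟩ := hc
  set v := E c w with hvdef
  have hTv : ∀ b, ρ (sqAff 1 b) v = ψ (b * c) • v := fun b => hE c b w
  let u : UnitSquares F → V := fun s => ρ (sqAff s 0) v
  have hTu : ∀ b s, ρ (sqAff 1 b) (u s)
      = ψ (b * (((s⁻¹ : UnitSquares F) : Fˣ) * c)) • u s := by
    intro b s
    simp only [u]
    rw [← Module.End.mul_apply, ← map_mul, sqAff_mul_translation, map_mul, Module.End.mul_apply,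
      hTv, map_smul]
    congr 2
    ring
  have hDu : ∀ s t, ρ (sqAff s 0) (u t) = u (s * t) := by
    intro s t
    simp only [u]
    rw [← Module.End.mul_apply, ← map_mul, sqAff_mul]
    simp
  have hu0 : ∀ s, u s ≠ 0 := by
    intro s hs
    have := hDu s⁻¹ s
    rw [hs, map_zero, inv_mul_cancel] at this
    exact hv (by rw [← hT0 v]; exact this.symm)
  -- Translations scale the vectors `u s` and the elements `sqAff s 0` permute them, so their span
  -- is invariant.
  have hspan : Submodule.span ℂ (Set.range u) = ⊤ := by
    refine hρ.eq_top _ (fun g x hx => ?_) fun h => ?_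
    · obtain ⟨s, b, rfl⟩ := sqAff_surjective g
      have hle : Submodule.span ℂ (Set.range u)
          ≤ (Submodule.span ℂ (Set.range u)).comap (ρ (sqAff s b)) := by
        rw [Submodule.span_le]
        rintro _ ⟨t, rfl⟩
        rw [SetLike.mem_coe, Submodule.mem_comap, sqAff_eq_mul, map_mul, Module.End.mul_apply,
          hDu, hTu]
        exact Submodule.smul_mem _ _ (Submodule.subset_span ⟨_, rfl⟩)
      exact hle hx
    · exact hu0 1 ((Submodule.mem_bot ℂ).1 (h ▸ Submodule.subset_span ⟨1, rfl⟩))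
  -- As $c\ne0$, the characters attached to different `s` differ; orthogonality lets `E` isolate one
  -- `u t`, which gives linear independence.
  have hEu : ∀ s t, E (((t⁻¹ : UnitSquares F) : Fˣ) * c) (u s)
      = if s = t then (Fintype.card F : ℂ) • u s else 0 := by
    intro s t
    simp only [E, hTu, smul_smul, ← AddChar.map_add_eq_mul, ← Finset.sum_smul]
    have : ∀ b : F, -(b * ((((t⁻¹ : UnitSquares F) : Fˣ) : F) * c))
        + b * ((((s⁻¹ : UnitSquares F) : Fˣ) : F) * c)
        = b * (((((s⁻¹ : UnitSquares F) : Fˣ) : F) - (((t⁻¹ : UnitSquares F) : Fˣ) : F)) * c) :=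
      fun b => by ring
    simp only [this, hsum]
    by_cases hst : s = t
    · simp [hst]
    · have : (((s⁻¹ : UnitSquares F) : Fˣ) : F) - (((t⁻¹ : UnitSquares F) : Fˣ) : F) ≠ 0 :=
        fun h => hst (inv_injective (Subtype.ext (Units.ext (sub_eq_zero.1 h))))
      rw [if_neg (mul_ne_zero this hc0), if_neg hst, zero_smul]
  have hli : LinearIndependent ℂ u := by
    rw [Fintype.linearIndependent_iff]
    intro a ha t
    have hlin : E (((t⁻¹ : UnitSquares F) : Fˣ) * c) (∑ s, a s • u s)
        = ∑ s, a s • E (((t⁻¹ : UnitSquares F) : Fˣ) * c) (u s) := by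
      simp only [E, map_sum, map_smul, Finset.smul_sum]
      rw [Finset.sum_comm]
      simp only [smul_comm (a _)]
    rw [ha] at hlin
    simp only [hEu, smul_ite, smul_zero, Finset.sum_ite_eq', Finset.mem_univ, if_true] at hlin
    have h0 : E (((t⁻¹ : UnitSquares F) : Fˣ) * c) 0 = 0 := by simp [E]
    rw [h0, smul_smul] at hlin
    have := (smul_eq_zero.1 hlin.symm).resolve_right (hu0 t)
    exact (mul_eq_zero.1 this).resolve_right hq
  rw [Module.finrank_eq_nat_card_basis (Module.Basis.mk hli hspan.ge)]

theorem character_one_eq [FiniteDimensional ℂ V] (hρ : ρ.IsIrreducible)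
    (hlin : ¬ IsLinearCharacter ρ.character) :
    ρ.character 1 = Nat.card (UnitSquares F) := by
  rw [Representation.char_one]
  by_cases h : ∀ (b : F) (w : V), ρ (sqAff 1 b) w = w
  · have := Finite.of_equiv _ (sqAffEquiv F)
    refine absurd (hρ.isLinearCharacter fun g g' => ?_) hlin
    obtain ⟨s, b, rfl⟩ := sqAff_surjective g
    obtain ⟨t, c, rfl⟩ := sqAff_surjective g'
    have h1 : ∀ b, ρ (sqAff 1 b) = 1 := fun b => LinearMap.ext fun w => h b w
    rw [sqAff_eq_mul s, sqAff_eq_mul t, map_mul, map_mul, h1, h1, one_mul, one_mul, ← map_mul,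
      ← map_mul, sqAff_mul, sqAff_mul, mul_comm s t]
    simp
  · push Not at h
    obtain ⟨b, w, hw⟩ := h
    rw [finrank_eq_card_unitSquares hρ hw]

theorem hasTwoCharacterDegrees_squareAffineGroup (hF : ringChar F ≠ 2)
    (hcard : 5 ≤ Nat.card F) : HasTwoCharacterDegrees (squareAffineGroup F) := by
  refine ⟨?_, ?_⟩
  · have hm := card_unitSquares hF
    have : Nontrivial (UnitSquares F) := Finite.one_lt_card_iff_nontrivial.1 (by omega)
    obtain ⟨s, hs⟩ := exists_ne (1 : UnitSquares F)
    refine ⟨sqAff s 0, sqAff 1 1, fun h => hs ?_⟩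
    rw [sqAff_mul, sqAff_mul, sqAff_inj] at h
    exact Subtype.ext (Units.ext (by simpa using h.2))
  · rintro _ _ ⟨n, ρ, hρ, rfl⟩ ⟨k, σ, hσ, rfl⟩ h1 h2
    rw [character_one_eq hρ h1, character_one_eq hσ h2]

end TwoDegrees

/-! ### The amenability constant -/

section Constant

/-- The only delicate signs come from $k\le(q-1)/(2q^2)$, that is $(q-1)^2\ge4$. In the last case
the absolute value is $1/(2q)+w(k+1/(2q^2))$. Being affine in $w$, it leaves no contribution of $w$
once $w=\pm\chi(b)\chi(c)$ is summed over $b$ and $c$. -/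
theorem abs_diagonal_entry {q k δ δ' w : ℝ} (hq : 3 ≤ q) (hk : k = ((q - 1) / 2 * q ^ 2)⁻¹)
    (h : (δ = 1 ∧ δ' = 1 ∧ w = 0) ∨ (δ = 1 ∧ δ' = 0 ∧ w = 0) ∨ (δ = 0 ∧ δ' = 1 ∧ w = 0) ∨
      (δ = 0 ∧ δ' = 0 ∧ (w = 1 ∨ w = -1))) :
    |k + 1 / 2 * ((δ - q⁻¹) * (δ' - q⁻¹) + w * q⁻¹)|
      = δ * δ' * (k + (q - 1) ^ 2 / (2 * q ^ 2))
        + (δ * (1 - δ') + δ' * (1 - δ)) * ((q - 1) / (2 * q ^ 2) - k)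
        + (1 - δ) * (1 - δ') * (1 / (2 * q)) + (k + 1 / (2 * q ^ 2)) * w := by
  have hq0 : 0 < q := by linarith
  have hq1 : 0 < q - 1 := by linarith
  have hk0 : 0 < k := by rw [hk]; positivity
  have hkle : k ≤ (q - 1) / (2 * q ^ 2) := by
    rw [hk, ← one_div, div_le_div_iff₀ (by positivity) (by positivity)]
    nlinarith [mul_nonneg (sq_nonneg q) (by nlinarith : 0 ≤ (q - 1) ^ 2 - 4)]
  rcases h with ⟨rfl, rfl, rfl⟩ | ⟨rfl, rfl, rfl⟩ | ⟨rfl, rfl, rfl⟩ | ⟨rfl, rfl, rfl | rfl⟩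
  · have : k + 1 / 2 * ((1 - q⁻¹) * (1 - q⁻¹) + 0 * q⁻¹) = k + (q - 1) ^ 2 / (2 * q ^ 2) := by
      field_simp; ring
    rw [this, abs_of_pos (by positivity)]
    ring
  · have : k + 1 / 2 * ((1 - q⁻¹) * (0 - q⁻¹) + 0 * q⁻¹) = -((q - 1) / (2 * q ^ 2) - k) := by
      field_simp; ring
    rw [this, abs_neg, abs_of_nonneg (by linarith)]
    ring
  · have : k + 1 / 2 * ((0 - q⁻¹) * (1 - q⁻¹) + 0 * q⁻¹) = -((q - 1) / (2 * q ^ 2) - k) := by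
      field_simp; ring
    rw [this, abs_neg, abs_of_nonneg (by linarith)]
    ring
  · have : k + 1 / 2 * ((0 - q⁻¹) * (0 - q⁻¹) + 1 * q⁻¹)
        = k + 1 / (2 * q ^ 2) + 1 / (2 * q) := by
      field_simp; ring
    rw [this, abs_of_pos (by positivity)]
    ring
  · have : k + 1 / 2 * ((0 - q⁻¹) * (0 - q⁻¹) + -1 * q⁻¹) = -((q - 1) / (2 * q ^ 2) - k) := by
      field_simp; ring
    rw [this, abs_neg, abs_of_nonneg (by linarith)]
    field_simp
    ring

variable {F : Type*} [Field F] [Fintype F] [DecidableEq F]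

/-- The idempotent complementary to the normalized sum of the translations. -/
noncomputable def translationComplement (F : Type*) [Field F] [Fintype F] :
    Subalgebra.center ℂ (MonoidAlgebra ℂ (squareAffineGroup F)) :=
  1 - (Fintype.card F : ℂ)⁻¹ • cosetSum 1

/-- The diagonal element of the centre of the group algebra of the `a²x + b` group. -/
noncomputable def sqAffDiagonal (F : Type*) [Field F] [Fintype F] [DecidableEq F] :
    Subalgebra.center ℂ (MonoidAlgebra ℂ (squareAffineGroup F)) ⊗[ℂ]
      Subalgebra.center ℂ (MonoidAlgebra ℂ (squareAffineGroup F)) :=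
  ((Fintype.card (UnitSquares F) : ℂ) * (Fintype.card F : ℂ) ^ 2)⁻¹ •
      ∑ s, cosetSum s ⊗ₜ[ℂ] cosetSum s⁻¹
    + (1 / 2 : ℂ) • (translationComplement F ⊗ₜ[ℂ] translationComplement F
      + ((quadraticChar F (-1) : ℂ) * Fintype.card F)⁻¹ • quadraticSum F ⊗ₜ[ℂ] quadraticSum F)

theorem isDiagonalElement_sqAffDiagonal (hF : ringChar F ≠ 2) :
    IsDiagonalElement _ (sqAffDiagonal F) := by
  have hq : (Fintype.card F : ℂ) ≠ 0 := Nat.cast_ne_zero.2 Fintype.card_ne_zero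
  refine isDiagonalElement_of_relations _ _ _ hq (mul_ne_zero ?_ hq) cosetSum_mul
    (cosetSum_mul_quadraticSum hF) rfl (quadraticSum_mul_self hF) (center_eq_combination hF)
  rcases quadraticChar_dichotomy (neg_ne_zero.2 (one_ne_zero (α := F))) with h | h <;> simp [h]

theorem translationComplement_coeff [DecidableEq (UnitSquares F)] (s : UnitSquares F) (b : F) :
    (translationComplement F).1.coeff (sqAff s b)
      = if s = 1 then (if b = 0 then 1 else 0) - (Fintype.card F : ℂ)⁻¹ else 0 := by
  have h : (translationComplement F).1.coeff (sqAff s b)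
      = (1 : MonoidAlgebra ℂ (squareAffineGroup F)).coeff (sqAff s b)
        - (Fintype.card F : ℂ)⁻¹ * (cosetSum 1).1.coeff (sqAff s b) := rfl
  rw [h, one_coeff, cosetSum_coeff]
  by_cases hs : s = 1 <;> simp [hs]

theorem tensorCoeff_sqAffDiagonal (s t : UnitSquares F) (b c : F) :
    tensorCoeff (sqAff s b) (sqAff t c) (sqAffDiagonal F)
      = (if t = s⁻¹ then ((Fintype.card (UnitSquares F) : ℂ) * (Fintype.card F : ℂ) ^ 2)⁻¹ else 0)
        + if s = 1 then if t = 1 then 1 / 2 *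
          (((if b = 0 then 1 else 0) - (Fintype.card F : ℂ)⁻¹) *
            ((if c = 0 then 1 else 0) - (Fintype.card F : ℂ)⁻¹)
          + ((quadraticChar F (-1) : ℂ) * Fintype.card F)⁻¹ *
            ((quadraticChar F b : ℂ) * quadraticChar F c)) else 0 else 0 := by
  rw [sqAffDiagonal]
  simp only [map_add, map_smul, map_sum, tensorCoeff_tmul, cosetSum_coeff, quadraticSum_coeff,
    translationComplement_coeff, smul_eq_mul]
  congr 1
  · rw [Finset.sum_eq_single s (fun x _ hx => by simp [Ne.symm hx]) (by simp)]
    simp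
  · by_cases hs : s = 1 <;> by_cases ht : t = 1 <;> simp [hs, ht]

theorem sum_norm_tensorCoeff_sqAffDiagonal (hF : ringChar F ≠ 2) (hcard : 3 ≤ Fintype.card F)
    [Fintype (squareAffineGroup F)] :
    ∑ p : squareAffineGroup F × squareAffineGroup F, ‖tensorCoeff p.1 p.2 (sqAffDiagonal F)‖
      = 1 + ((Fintype.card F : ℝ) + 1) / 2 * (1 - 9 / (Fintype.card F : ℝ) ^ 2) := by
  obtain ⟨q, hqdef⟩ : ∃ q : ℝ, q = Fintype.card F := ⟨_, rfl⟩
  rw [← hqdef]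
  have hq : 3 ≤ q := by rw [hqdef]; exact_mod_cast hcard
  have hm : (Fintype.card (UnitSquares F) : ℝ) = (q - 1) / 2 := by
    have := card_unitSquares hF
    rw [Nat.card_eq_fintype_card, Nat.card_eq_fintype_card] at this
    rw [hqdef, ← this]
    push_cast
    ring
  set k : ℝ := ((q - 1) / 2 * q ^ 2)⁻¹ with hk
  have hk0 : 0 ≤ k := inv_nonneg.2 (mul_nonneg (by linarith) (by positivity))
  have hkC : ((Fintype.card (UnitSquares F) : ℂ) * (Fintype.card F : ℂ) ^ 2)⁻¹ = (k : ℂ) := by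
    rw [hk, ← hm, hqdef]
    push_cast
    rfl
  obtain ⟨ε, hε, hεC⟩ : ∃ ε : ℝ, (ε = 1 ∨ ε = -1) ∧ (quadraticChar F (-1) : ℂ) = ε := by
    rcases quadraticChar_dichotomy (neg_ne_zero.2 (one_ne_zero (α := F))) with h | h
    · exact ⟨1, Or.inl rfl, by simp [h]⟩
    · exact ⟨-1, Or.inr rfl, by simp [h]⟩
  let δ : F → ℝ := fun b => if b = 0 then 1 else 0
  let χ : F → ℝ := fun b => (quadraticChar F b : ℝ)
  let N : F → F → ℝ := fun b c => |k + 1 / 2 * ((δ b - q⁻¹) * (δ c - q⁻¹) + ε * (χ b * χ c) * q⁻¹)|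
  have hδ : ∑ b, δ b = 1 := by simp [δ]
  have hδ' : ∑ b, (1 - δ b) = q - 1 := by
    rw [Finset.sum_sub_distrib, hδ]; simp [hqdef]
  have hχ : ∑ b, χ b = 0 := by
    simp only [χ]
    exact_mod_cast quadraticChar_sum_zero hF
  have hN : ∀ b c, N b c = δ b * δ c * (k + (q - 1) ^ 2 / (2 * q ^ 2))
        + (δ b * (1 - δ c) + δ c * (1 - δ b)) * ((q - 1) / (2 * q ^ 2) - k)
        + (1 - δ b) * (1 - δ c) * (1 / (2 * q)) + (k + 1 / (2 * q ^ 2)) * (ε * (χ b * χ c)) := by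
    intro b c
    refine abs_diagonal_entry hq hk ?_
    by_cases hb : b = 0 <;> by_cases hc : c = 0
    · simp [δ, χ, hb, hc]
    · simp [δ, χ, hb, hc]
    · simp [δ, χ, hb, hc]
    · refine Or.inr (Or.inr (Or.inr ⟨by simp [δ, hb], by simp [δ, hc], ?_⟩))
      rcases hε with h | h <;> rcases quadraticChar_dichotomy hb with h1 | h1 <;>
        rcases quadraticChar_dichotomy hc with h2 | h2 <;>
        simp only [χ, h, h1, h2] <;> norm_num
  have hsumN : ∑ b, ∑ c, N b c = (k + (q - 1) ^ 2 / (2 * q ^ 2))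
      + 2 * (q - 1) * ((q - 1) / (2 * q ^ 2) - k) + (q - 1) ^ 2 * (1 / (2 * q)) := by
    simp only [hN, Finset.sum_add_distrib, ← Finset.sum_mul, ← Finset.mul_sum, hδ, hδ', hχ]
    ring
  -- The value `k` is split off on all of $t=s^{-1}$, where it sums to $mq^2k=1$; only the block
  -- $s=t=1$ needs a correction.
  have hentry : ∀ (s t : UnitSquares F) (b c : F),
      ‖tensorCoeff (sqAff s b) (sqAff t c) (sqAffDiagonal F)‖
        = (if t = s⁻¹ then k else 0) + if t = 1 then if s = 1 then N b c - k else 0 else 0 := by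
    intro s t b c
    rw [tensorCoeff_sqAffDiagonal, hkC, hεC]
    by_cases hs : s = 1
    · by_cases ht : t = 1
      · simp only [hs, ht, inv_one, if_true, N]
        rw [add_sub_cancel, ← Real.norm_eq_abs, ← Complex.norm_real]
        congr 1
        -- The sign `ε` is its own inverse.
        have hεinv : ((ε : ℂ) * Fintype.card F)⁻¹ = ε * (Fintype.card F : ℂ)⁻¹ := by
          rw [mul_inv]
          rcases hε with h | h <;> norm_num [h]
        rw [hεinv]
        by_cases hb : b = 0 <;> by_cases hc : c = 0 <;> simp [δ, χ, hqdef, hb, hc] <;>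
          ring
      · simp [hs, ht]
    · by_cases ht : t = s⁻¹
      · simp [hs, ht, abs_of_nonneg hk0]
      · simp [hs, ht]
  rw [← Equiv.sum_comp ((sqAffEquiv F).prodCongr (sqAffEquiv F))]
  simp only [Fintype.sum_prod_type, Equiv.prodCongr_apply, Prod.map, sqAffEquiv_apply, hentry]
  have hreorder : ∀ s : UnitSquares F, ∑ b : F, ∑ t : UnitSquares F, ∑ c : F,
      ((if t = s⁻¹ then k else 0) + if t = 1 then if s = 1 then N b c - k else 0 else 0)
      = q ^ 2 * k + if s = 1 then ∑ b, ∑ c, N b c - q ^ 2 * k else 0 := by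
    intro s
    have h1 : ∀ b : F, ∑ t : UnitSquares F, ∑ c : F,
        ((if t = s⁻¹ then k else 0) + if t = 1 then if s = 1 then N b c - k else 0 else 0)
        = q * k + if s = 1 then ∑ c, N b c - q * k else 0 := by
      intro b
      rw [Finset.sum_comm]
      simp only [Finset.sum_add_distrib, Finset.sum_ite_eq', Finset.mem_univ, if_true,
        Finset.sum_const, Finset.card_univ, nsmul_eq_mul]
      split_ifs <;> simp [Finset.sum_sub_distrib, hqdef]
    rw [Finset.sum_congr rfl fun b _ => h1 b]
    simp only [Finset.sum_add_distrib, Finset.sum_const, Finset.card_univ, nsmul_eq_mul]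
    split_ifs <;> simp [Finset.sum_sub_distrib, hqdef] <;> ring
  rw [Finset.sum_congr rfl fun s _ => hreorder s]
  simp only [Finset.sum_add_distrib, Finset.sum_ite_eq', Finset.mem_univ, if_true,
    Finset.sum_const, Finset.card_univ, nsmul_eq_mul, hm, hsumN]
  have hq0 : q ≠ 0 := by linarith
  have hq1 : q - 1 ≠ 0 := by linarith
  rw [hk]
  field_simp
  ring

theorem zlAmenabilityConstant_squareAffineGroup {F : Type*} [Field F] [Finite F]
    (hF : ringChar F ≠ 2) (hcard : 3 ≤ Nat.card F) :
    zlAmenabilityConstant (squareAffineGroup F)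
      = 1 + ((Nat.card F : ℝ) + 1) / 2 * (1 - 9 / (Nat.card F : ℝ) ^ 2) := by
  classical
  have := Fintype.ofFinite F
  have := Fintype.ofFinite (squareAffineGroup F)
  rw [Nat.card_eq_fintype_card] at hcard ⊢
  rw [← sum_norm_tensorCoeff_sqAffDiagonal hF hcard]
  exact zlAmenabilityConstant_eq_sum (isDiagonalElement_sqAffDiagonal hF)

theorem hasTwoCharacterDegrees_and_zlAmenabilityConstant (F : Type*) [Field F] [Finite F] (q : ℕ)
    (hq : Nat.card F = q) (hodd : Odd q) (h5 : 5 ≤ q) :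
    HasTwoCharacterDegrees (squareAffineGroup F) ∧
      zlAmenabilityConstant (squareAffineGroup F)
        = 1 + ((q : ℝ) + 1) / 2 * (1 - 9 / (q : ℝ) ^ 2) := by
  have := Fintype.ofFinite F
  have hF : ringChar F ≠ 2 := fun h => by
    have := FiniteField.even_card_iff_char_two.1 h
    rw [← Nat.card_eq_fintype_card, hq] at this
    rw [Nat.odd_iff] at hodd
    omega
  subst hq
  exact ⟨hasTwoCharacterDegrees_squareAffineGroup hF h5,
    zlAmenabilityConstant_squareAffineGroup hF (by omega)⟩

end Constant

theorem mainTheorem8 :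
    (∀ (F : Type*) [Field F] [Finite F] (q : ℕ), Nat.card F = q → Odd q → 5 ≤ q →
      HasTwoCharacterDegrees (squareAffineGroup F) ∧
      zlAmenabilityConstant (squareAffineGroup F)
        = 1 + ((q : ℝ) + 1) / 2 * (1 - 9 / (q : ℝ) ^ 2)) ∧
    (∀ C : ℝ, ∃ (G : Type) (_ : Group G) (_ : Finite G),
      HasTwoCharacterDegrees G ∧ C < zlAmenabilityConstant G) := by
  refine ⟨fun F _ _ q => hasTwoCharacterDegrees_and_zlAmenabilityConstant F q, fun C => ?_⟩
  -- For $p\ge5$ the factor $1-9/p^2$ is at least $1/2$, so the constant exceeds $(p+1)/4$ and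
  -- $p>4C$ suffices.
  obtain ⟨n, hn⟩ := exists_nat_gt (4 * C)
  obtain ⟨p, hp, hprime⟩ := Nat.exists_infinite_primes (max n 5)
  have := Fact.mk hprime
  have hp5 : 5 ≤ p := (le_max_right _ _).trans hp
  obtain ⟨h1, h2⟩ := hasTwoCharacterDegrees_and_zlAmenabilityConstant (ZMod p) p (by simp)
    (hprime.odd_of_ne_two (by omega)) hp5
  refine ⟨_, inferInstance, inferInstance, h1, ?_⟩
  have hpC : 4 * C < p := hn.trans_le (by exact_mod_cast (le_max_left _ _).trans hp)
  have hp5' : (5 : ℝ) ≤ p := by exact_mod_cast hp5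
  have h3 : 1 / 2 ≤ 1 - 9 / (p : ℝ) ^ 2 := by
    have : 9 / (p : ℝ) ^ 2 ≤ 1 / 2 := by
      rw [div_le_div_iff₀ (by positivity) (by norm_num)]
      nlinarith
    linarith
  have h4 : ((p : ℝ) + 1) / 2 * (1 / 2) ≤ (p + 1) / 2 * (1 - 9 / (p : ℝ) ^ 2) :=
    mul_le_mul_of_nonneg_left h3 (by positivity)
  rw [h2]
  linarith
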